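/- Graphs are finite, simple and undirected. A set function $\varphi\colon 2^V\to\mathbb{R}$ on a finite set $V$ is submodular if $\varphi(X)+\varphi(Y)\ge\varphi(X\cap Y)+\varphi(X\cup Y)$ for all $X,Y\subseteq V$, and $\|\varphi\|=\max_{X\subseteq V}|\varphi(X)|$. If $\varphi(\emptyset)=0$, a monotonic sum-decomposition of $\varphi$ is an expression $\varphi=\varphi_1+\varphi_2$ with $\varphi_1,\varphi_2\colon 2^V\to\mathbb{R}$ submodular, $\varphi_1$ increasing and $\varphi_2$ decreasing with respect to inclusion, and $\varphi_1(\emptyset)=\varphi_2(\emptyset)=0$. For $c\in\mathbb{R}$ it is called $c$-bounded if $\|\varphi_i\|\le c\,\|\varphi\|$ for $i=1,2$. For a graph $G=(V,E)$ with edge weights $w\colon E\to\mathbb{R}_{\ge 0}$ and $X\subseteq V$, let $d_w(X)$ be the total weight of the edges with exactly one endpoint in $X$ (the weighted cut function), $i_w(X)$ the total weight of the edges with both endpoints in $X$, and $e_w(X)=i_w(X)+d_w(X)$. For $w\equiv 1$ we write $d=d_w$; this is the cut function of $G$. The factor $2$ of the decomposition $d_w=e_w+(-i_w)$ is optimal,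 in the following sense. 1. For every graph $G$ and every $w\colon E\to\mathbb{R}_{\ge 0}$, $d_w=e_w+(-i_w)$ is a $2$-bounded monotonic sum-decomposition of $d_w$. 2. For every real $c<2$ there exists a graph $G$ whose (unweighted) cut function $d$ does not admit a $c$-bounded monotonic sum-decomposition. -/

import Mathlib

namespace SetFn

/-- A set function on all subsets of `J` is submodular if
`φ X + φ Y ≥ φ (X ∩ Y) + φ (X ∪ Y)` for all `X`, `Y`. -/
def Submodular {J : Type*} (φ : Set J → ℝ) : Prop :=
  ∀ X Y : Set J, φ (X ∩ Y) + φ (X ∪ Y) ≤ φ X + φ Y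

/-- The norm `‖φ‖ = sup {|φ X| : X ⊆ J}` of a set function on a finite ground set
(the supremum of a nonempty finite set of reals, hence a maximum). -/
noncomputable def norm {J : Type*} [Finite J] (φ : Set J → ℝ) : ℝ :=
  ⨆ X : Set J, |φ X|

/-- `φ = φ₁ + φ₂` is a monotonic sum-decomposition of `φ`. -/
structure IsMonotonicSumDecomp {J : Type*} (φ φ₁ φ₂ : Set J → ℝ) : Prop where
  eq_add : ∀ X, φ X = φ₁ X + φ₂ X
  increasing : Monotone φ₁
  decreasing : Antitone φ₂
  submodular_left : Submodular φ₁
  submodular_right : Submodular φ₂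
  empty_left : φ₁ ∅ = 0
  empty_right : φ₂ ∅ = 0

/-- `φ = φ₁ + φ₂` is a `c`-bounded monotonic sum-decomposition of `φ`. -/
structure IsBoundedMonotonicSumDecomp {J : Type*} [Finite J] (c : ℝ)
    (φ φ₁ φ₂ : Set J → ℝ) : Prop extends IsMonotonicSumDecomp φ φ₁ φ₂ where
  norm_left_le : norm φ₁ ≤ c * norm φ
  norm_right_le : norm φ₂ ≤ c * norm φ

end SetFn

namespace GraphCut

variable {V : Type*}

/-- The edges of `G` connecting `X \ Y` and `Y \ X`. -/
def edgesBetween (G : SimpleGraph V) (X Y : Set V) : Set (Sym2 V) :=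
  {e | e ∈ G.edgeSet ∧ (∃ v ∈ e, v ∈ X \ Y) ∧ ∃ v ∈ e, v ∈ Y \ X}

/-- The edges of `G` induced by `X`. -/
def edgesInside (G : SimpleGraph V) (X : Set V) : Set (Sym2 V) :=
  {e | e ∈ G.edgeSet ∧ ∀ v ∈ e, v ∈ X}

/-- The total weight of a set of edges. Throughout, a weight function is given on all unordered
pairs of vertices, but only its values on the edges of the graph are ever used. -/
noncomputable def weight [Finite V] (w : Sym2 V → ℝ) (F : Set (Sym2 V)) : ℝ :=
  ∑ᶠ e ∈ F, w e

/-- The weighted cut function `d_w`. -/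
noncomputable def weightedCut [Finite V] (G : SimpleGraph V) (w : Sym2 V → ℝ) (X : Set V) : ℝ :=
  weight w (edgesBetween G X Xᶜ)

/-- The weight `i_w X` of the edges induced by `X`. -/
noncomputable def inducedWeight [Finite V] (G : SimpleGraph V) (w : Sym2 V → ℝ) (X : Set V) : ℝ :=
  weight w (edgesInside G X)

/-- `e_w X = i_w X + d_w X`, the weight of the edges incident to `X`. -/
noncomputable def incidentWeight [Finite V] (G : SimpleGraph V) (w : Sym2 V → ℝ) (X : Set V) : ℝ :=
  inducedWeight G w X + weightedCut G w X

/-- The (unweighted) cut function `d`: `d X` is the number of edges leaving `X`. -/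
noncomputable def cut [Finite V] (G : SimpleGraph V) (X : Set V) : ℝ :=
  weightedCut G (fun _ => 1) X

end GraphCut

/-! The first claim is checked edge by edge. Its constant comes from averaging: a uniformly random
`X` cuts each edge with probability 1/2, so some cut carries at least half of the total weight,
which is the norm of both summands.

For optimality, let `G` be triangle-free and let `φ₁ + φ₂` be any monotonic sum-decomposition of its
cut function. Second differences of `d` along nonadjacent pairs vanish, and those of the submodular
`φ₁`, `φ₂` are nonpositive, so they vanish too. Any three vertices contain a nonadjacent pair, so
all third differences of `φ₁` vanish and `φ₁` is quadratic. Monotonicity then forces `φ₁ V ≥ |E|`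
(`sum_degree_le_of_triangleFree`).

It remains to find triangle-free graphs whose maximum cut is at most `(1/2 + o(1))|E|`. The
Vandermonde graphs over prime fields qualify: their quadratic form on sign vectors is bounded below
by Cauchy–Schwarz and an orthogonality of quadratic shifts (`cut_vandermondeGraph_le`). -/

/-! ### Quadratic set functions -/

open Finset in
/-- If all mixed second differences of `F` are independent of the base set, then twice the value of
`F` is the sum of its values on singletons and of its last marginals. -/
theorem SetFn.two_mul_eq_sum_of_const_second_diff {V : Type*} [DecidableEq V]
    (F : Finset V → ℝ) (h0 : F ∅ = 0)
    (D : V → V → ℝ) (hD : ∀ (S : Finset V) (v w : V), v ≠ w → v ∉ S → w ∉ S →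
      F (insert v (insert w S)) - F (insert v S) - F (insert w S) + F S = D v w)
    (S : Finset V) :
    2 * F S = ∑ v ∈ S, F {v} + ∑ v ∈ S, (F S - F (S.erase v)) := by
  have marginal : ∀ (S : Finset V) (w : V), w ∉ S →
      F (insert w S) - F S = F {w} + ∑ v ∈ S, D v w := by
    intro S w
    induction S using Finset.induction_on with
    | empty => intro _; simp [h0]
    | insert v S hv ih =>
      intro hw
      rw [mem_insert, not_or] at hw
      have h1 := ih hw.2
      have h2 := hD S v w (Ne.symm hw.1) hv hw.2
      rw [sum_insert hv, Finset.insert_comm]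
      linarith
  induction S using Finset.induction_on with
  | empty => simp [h0]
  | insert w S hw ih =>
    have hm := marginal S w hw
    rw [sum_insert hw, sum_insert hw, erase_insert hw]
    -- Adding `w` raises the last marginal of each `v ∈ S` by `D v w`. With the marginal of `w`
    -- itself, each pair is thus counted twice, once from either end.
    have key : ∑ v ∈ S, (F (insert w S) - F ((insert w S).erase v))
        = ∑ v ∈ S, (F S - F (S.erase v)) + ∑ v ∈ S, D v w := by
      rw [← sum_add_distrib]
      refine sum_congr rfl fun v hv => ?_
      have hvw : v ≠ w := fun h => hw (h ▸ hv)
      have h3 := hD (S.erase v) v w hvw (notMem_erase v S) (fun h => hw (mem_of_mem_erase h))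
      rw [Finset.insert_comm, insert_erase hv] at h3
      rw [erase_insert_of_ne (Ne.symm hvw)]
      linarith
    rw [key]
    linarith

/-- If all mixed third differences of `F` vanish, its mixed second differences are independent of
the base set. -/
theorem SetFn.second_diff_eq_of_third_diff_eq_zero {V : Type*} [DecidableEq V]
    (F : Finset V → ℝ) (h0 : F ∅ = 0)
    (h3 : ∀ (S : Finset V) (u v w : V), u ≠ v → u ≠ w → v ≠ w → u ∉ S → v ∉ S → w ∉ S →
      F (insert v (insert w (insert u S))) - F (insert v (insert u S))
          - F (insert w (insert u S)) + F (insert u S)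
        = F (insert v (insert w S)) - F (insert v S) - F (insert w S) + F S)
    (S : Finset V) (v w : V) (hvw : v ≠ w) (hv : v ∉ S) (hw : w ∉ S) :
    F (insert v (insert w S)) - F (insert v S) - F (insert w S) + F S
      = F {v, w} - F {v} - F {w} := by
  induction S using Finset.induction_on with
  | empty => simp [h0]
  | insert u S hu ih =>
    rw [Finset.mem_insert, not_or] at hv hw
    rw [h3 S u v w (Ne.symm hv.1) (Ne.symm hw.1) hvw hu hv.2 hw.2]
    exact ih hv.2 hw.2

theorem SetFn.abs_le_norm {J : Type*} [Finite J] (φ : Set J → ℝ) (X : Set J) :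
    |φ X| ≤ SetFn.norm φ :=
  le_ciSup (f := fun X => |φ X|) (Set.finite_range _).bddAbove X

theorem SetFn.norm_le {J : Type*} [Finite J] (φ : Set J → ℝ) {a : ℝ} (h : ∀ X, |φ X| ≤ a) :
    SetFn.norm φ ≤ a :=
  ciSup_le h

/-! ### The 2-bounded decomposition -/

namespace GraphCut

theorem weight_eq_sum {V : Type*} [Finite V] [Fintype (Sym2 V)] (w : Sym2 V → ℝ)
    (F : Set (Sym2 V)) : weight w F = ∑ e, F.indicator w e := by
  unfold weight
  rw [finsum_mem_def, finsum_eq_sum_of_fintype]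

open Classical in
theorem indicator_edgesInside {V : Type*} (G : SimpleGraph V) (w : Sym2 V → ℝ) (X : Set V)
    (u v : V) : (edgesInside G X).indicator w s(u, v)
      = if G.Adj u v ∧ u ∈ X ∧ v ∈ X then w s(u, v) else 0 := by
  simp [Set.indicator_apply, edgesInside]

open Classical in
theorem indicator_edgesBetween {V : Type*} (G : SimpleGraph V) (w : Sym2 V → ℝ) (X : Set V)
    (u v : V) : (edgesBetween G X Xᶜ).indicator w s(u, v)
      = if G.Adj u v ∧ ¬ (u ∈ X ↔ v ∈ X) then w s(u, v) else 0 := by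
  have : s(u, v) ∈ edgesBetween G X Xᶜ ↔ G.Adj u v ∧ ¬ (u ∈ X ↔ v ∈ X) := by
    simp only [edgesBetween, Set.mem_ofPred_eq, SimpleGraph.mem_edgeSet, Sym2.mem_iff,
      Set.mem_sdiff, Set.mem_compl_iff, exists_eq_or_imp, exists_eq_left]
    tauto
  simp [Set.indicator_apply, this]

theorem weight_univ_le_two_mul_norm {V : Type*} [Finite V] (G : SimpleGraph V) (w : Sym2 V → ℝ) :
    inducedWeight G w Set.univ ≤ 2 * SetFn.norm (weightedCut G w) := by
  classical
  have := Fintype.ofFinite V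
  have edge (e : Sym2 V) : 2 * ∑ X : Set V, (edgesBetween G X Xᶜ).indicator w e
      = ∑ _X : Set V, (edgesInside G Set.univ).indicator w e := by
    induction e with | _ u v
    -- Toggling `u` pairs up the vertex sets, and an edge `uv` is cut by exactly one set of each
    -- pair.
    have hinv : Function.Involutive fun X : Set V => symmDiff X {u} := fun X => by
      simp
    have hsw : ∑ X : Set V, (edgesBetween G X Xᶜ).indicator w s(u, v)
        = ∑ X : Set V, (edgesBetween G (symmDiff X {u}) (symmDiff X {u})ᶜ).indicator w s(u, v) :=
      (Equiv.sum_comp hinv.toPerm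
        fun X : Set V => (edgesBetween G X Xᶜ).indicator w s(u, v)).symm
    rw [two_mul]
    nth_rewrite 2 [hsw]
    rw [← Finset.sum_add_distrib]
    refine Finset.sum_congr rfl fun X _ => ?_
    rw [indicator_edgesBetween, indicator_edgesBetween, indicator_edgesInside]
    by_cases ha : G.Adj u v
    · have hne := ha.ne'
      by_cases hu : u ∈ X <;> by_cases hv : v ∈ X <;> simp [ha, hu, hv, hne, Set.mem_symmDiff]
    · simp [ha]
  have total : 2 * ∑ X : Set V, weightedCut G w X
      = ∑ _X : Set V, inducedWeight G w Set.univ := by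
    simp only [weightedCut, inducedWeight, weight_eq_sum]
    rw [Finset.sum_comm, Finset.mul_sum, Finset.sum_comm (γ := Set V)]
    exact Finset.sum_congr rfl fun e _ => edge e
  rw [Finset.mul_sum] at total
  obtain ⟨X, -, hX⟩ := Finset.exists_le_of_sum_le Finset.univ_nonempty total.ge
  have := (le_abs_self _).trans (SetFn.abs_le_norm (weightedCut G w) X)
  linarith

theorem isBoundedMonotonicSumDecomp_weightedCut {V : Type*} [Finite V] (G : SimpleGraph V)
    (w : Sym2 V → ℝ) (hw : ∀ e ∈ G.edgeSet, 0 ≤ w e) :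
    SetFn.IsBoundedMonotonicSumDecomp 2 (weightedCut G w)
      (incidentWeight G w) (fun X => -inducedWeight G w X) := by
  classical
  have := Fintype.ofFinite V
  have hw' (u v : V) (h : G.Adj u v) : 0 ≤ w s(u, v) := hw _ h
  have inside_mono : Monotone (inducedWeight G w) := by
    intro X Y hXY
    simp only [inducedWeight, weight_eq_sum]
    refine Finset.sum_le_sum fun e _ => ?_
    induction e with | _ u v
    rw [indicator_edgesInside, indicator_edgesInside]
    have hu := @hXY u
    have hv := @hXY v
    have := hw' u v
    grind
  have incident_mono : Monotone (incidentWeight G w) := by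
    intro X Y hXY
    simp only [incidentWeight, inducedWeight, weightedCut, weight_eq_sum,
      ← Finset.sum_add_distrib]
    refine Finset.sum_le_sum fun e _ => ?_
    induction e with | _ u v
    simp only [indicator_edgesInside, indicator_edgesBetween]
    have hu := @hXY u
    have hv := @hXY v
    have := hw' u v
    grind
  have inside_empty : inducedWeight G w ∅ = 0 := by
    simp only [inducedWeight, weight_eq_sum]
    refine Finset.sum_eq_zero fun e _ => ?_
    induction e with | _ u v
    simp [indicator_edgesInside]
  have incident_empty : incidentWeight G w ∅ = 0 := by
    rw [incidentWeight, inside_empty, zero_add, weightedCut, weight_eq_sum]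
    refine Finset.sum_eq_zero fun e _ => ?_
    induction e with | _ u v
    rw [indicator_edgesBetween]
    simp
  have cut_univ : weightedCut G w Set.univ = 0 := by
    rw [weightedCut, weight_eq_sum]
    refine Finset.sum_eq_zero fun e _ => ?_
    induction e with | _ u v
    rw [indicator_edgesBetween]
    simp
  have total := weight_univ_le_two_mul_norm G w
  refine ⟨⟨fun X => by simp [incidentWeight], incident_mono, fun X Y h => neg_le_neg (inside_mono h),
    ?_, ?_, incident_empty, by simp [inside_empty]⟩, ?_, ?_⟩
  · intro X Y
    simp only [incidentWeight, inducedWeight, weightedCut, weight_eq_sum,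
      ← Finset.sum_add_distrib]
    refine Finset.sum_le_sum fun e _ => ?_
    induction e with | _ u v
    simp only [indicator_edgesInside, indicator_edgesBetween, Set.mem_inter_iff, Set.mem_union]
    by_cases ha : G.Adj u v
    · have := hw' u v ha
      by_cases u ∈ X <;> by_cases v ∈ X <;> by_cases u ∈ Y <;> by_cases v ∈ Y <;> simp [*]
    · simp [ha]
  · intro X Y
    simp only [inducedWeight, weight_eq_sum, ← Finset.sum_add_distrib, ← Finset.sum_neg_distrib]
    refine Finset.sum_le_sum fun e _ => ?_
    induction e with | _ u v
    simp only [indicator_edgesInside, Set.mem_inter_iff, Set.mem_union]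
    have := hw' u v
    grind
  · refine SetFn.norm_le _ fun X => ?_
    have h0 := incident_mono (Set.empty_subset X)
    have h1 := incident_mono (Set.subset_univ X)
    rw [incident_empty] at h0
    rw [incidentWeight.eq_def G w Set.univ, cut_univ, add_zero] at h1
    rw [abs_of_nonneg h0]
    exact h1.trans total
  · refine SetFn.norm_le _ fun X => ?_
    have h0 := inside_mono (Set.empty_subset X)
    rw [inside_empty] at h0
    rw [abs_neg, abs_of_nonneg h0]
    exact (inside_mono (Set.subset_univ X)).trans total

/-! ### Decompositions for triangle-free graphs -/

open Classical in
theorem cut_eq_sum {V : Type*} [Fintype V] (G : SimpleGraph V) (X : Set V) :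
    cut G X = ∑ u, ∑ v, if G.Adj u v ∧ u ∈ X ∧ v ∉ X then (1 : ℝ) else 0 := by
  have himage : edgesBetween G X Xᶜ = ↑(Finset.image (fun q : V × V => s(q.1, q.2))
      {q | G.Adj q.1 q.2 ∧ q.1 ∈ X ∧ q.2 ∉ X}) := by
    ext e
    induction e with | _ u v
    simp only [edgesBetween, Set.mem_ofPred_eq, SimpleGraph.mem_edgeSet, Sym2.mem_iff,
      Set.mem_sdiff, Set.mem_compl_iff, exists_eq_or_imp, exists_eq_left, Finset.coe_image,
      Finset.coe_filter, Finset.mem_univ, true_and, Set.mem_image, Prod.exists, Sym2.eq_iff]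
    constructor
    · rintro ⟨ha, h1, h2⟩
      have hb := ha.symm
      by_cases hu : u ∈ X
      · exact ⟨u, v, ⟨ha, hu, by tauto⟩, Or.inl ⟨rfl, rfl⟩⟩
      · exact ⟨v, u, ⟨hb, by tauto, hu⟩, Or.inr ⟨rfl, rfl⟩⟩
    · rintro ⟨a, b, ⟨hab, ha, hb⟩, ⟨rfl, rfl⟩ | ⟨rfl, rfl⟩⟩
      · exact ⟨hab, by tauto, by tauto⟩
      · exact ⟨hab.symm, by tauto, by tauto⟩
  rw [cut, weightedCut, weight, himage, finsum_mem_coe_finset, Finset.sum_image, Finset.sum_filter,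
    Fintype.sum_prod_type]
  rintro ⟨a, b⟩ hab ⟨c, d⟩ hcd h
  simp only [Finset.coe_filter, Finset.mem_univ, true_and, Set.mem_ofPred_eq] at hab hcd
  rcases Sym2.eq_iff.1 h with ⟨rfl, rfl⟩ | ⟨rfl, rfl⟩
  · rfl
  · exact absurd hab.2.1 hcd.2.2

open Classical in
/-- The second difference of the cut function vanishes along a pair of nonadjacent vertices. -/
theorem cut_second_diff {V : Type*} [Finite V] (G : SimpleGraph V) (X : Set V) {u v : V}
    (huv : ¬ G.Adj u v) (hne : u ≠ v) :
    cut G (insert u (insert v X)) + cut G X = cut G (insert u X) + cut G (insert v X) := by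
  have := Fintype.ofFinite V
  have hvu : ¬ G.Adj v u := fun h => huv h.symm
  simp only [cut_eq_sum, ← Finset.sum_add_distrib]
  refine Finset.sum_congr rfl fun a _ => Finset.sum_congr rfl fun b _ => ?_
  simp only [Set.mem_insert_iff]
  grind

-- The left side is `2|E|`. In the quadratic identity for `φ₁` on the whole vertex set, the last
-- marginals are nonnegative and each singleton value is at least the degree.
open Classical in
theorem sum_degree_le_of_triangleFree {V : Type*} [Fintype V] (G : SimpleGraph V)
    (hG : ∀ u v w, G.Adj u v → G.Adj u w → ¬ G.Adj v w) {φ₁ φ₂ : Set V → ℝ}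
    (h : SetFn.IsMonotonicSumDecomp (cut G) φ₁ φ₂) :
    ∑ u, ∑ v, (if G.Adj u v then (1 : ℝ) else 0) ≤ 2 * φ₁ Set.univ := by
  -- Two nonpositive second differences with sum zero are both zero.
  have second (X : Set V) (u v : V) (huv : ¬ G.Adj u v) (hne : u ≠ v) (hu : u ∉ X) (hv : v ∉ X) :
      φ₁ (insert u (insert v X)) - φ₁ (insert u X) - φ₁ (insert v X) + φ₁ X = 0 := by
    have hI : (insert u X) ∩ (insert v X) = X := by ext; grind
    have hU : (insert u X) ∪ (insert v X) = insert u (insert v X) := by ext; grind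
    have h1 := h.submodular_left (insert u X) (insert v X)
    have h2 := h.submodular_right (insert u X) (insert v X)
    have h3 := cut_second_diff G X huv hne
    simp only [h.eq_add] at h3
    rw [hI, hU] at h1 h2
    linarith
  let F : Finset V → ℝ := fun S => φ₁ S
  have hF0 : F ∅ = 0 := by simpa [F] using h.empty_left
  have second' (S : Finset V) (u v : V) (huv : ¬ G.Adj u v) (hne : u ≠ v) (hu : u ∉ S)
      (hv : v ∉ S) : F (insert u (insert v S)) - F (insert u S) - F (insert v S) + F S = 0 := by
    simpa [F] using second S u v huv hne (by simpa using hu) (by simpa using hv)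
  have third : ∀ (S : Finset V) (u v w : V), u ≠ v → u ≠ w → v ≠ w → u ∉ S → v ∉ S → w ∉ S →
      F (insert v (insert w (insert u S))) - F (insert v (insert u S))
          - F (insert w (insert u S)) + F (insert u S)
        = F (insert v (insert w S)) - F (insert v S) - F (insert w S) + F S := by
    intro S u v w huv huw hvw hu hv hw
    -- A third difference is symmetric in `u`, `v`, `w`, so it may be taken as a difference of
    -- second differences along whichever pair is nonadjacent.
    by_cases h1 : G.Adj u v
    · by_cases h2 : G.Adj u w
      · have h3 := hG u v w h1 h2
        rw [second' S v w h3 hvw hv hw,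
          second' (insert u S) v w h3 hvw (by simp [hv, huv.symm]) (by simp [hw, huw.symm])]
      · have e1 := second' S u w h2 huw hu hw
        have e2 := second' (insert v S) u w h2 huw (by simp [hu, huv]) (by simp [hw, hvw.symm])
        have p1 : insert v (insert w (insert u S)) = insert u (insert w (insert v S)) := by
          ext; simp; tauto
        rw [p1, Finset.insert_comm v u, Finset.insert_comm w u, Finset.insert_comm v w]
        linarith
    · have e1 := second' S u v h1 huv hu hv
      have e2 := second' (insert w S) u v h1 huv (by simp [hu, huw]) (by simp [hv, hvw])
      have p1 : insert v (insert w (insert u S)) = insert u (insert v (insert w S)) := by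
        ext; simp; tauto
      rw [p1, Finset.insert_comm v u, Finset.insert_comm w u]
      linarith
  have key := SetFn.two_mul_eq_sum_of_const_second_diff F hF0
    (fun v w => F {v, w} - F {v} - F {w})
    (SetFn.second_diff_eq_of_third_diff_eq_zero F hF0 third) Finset.univ
  have hmarg : 0 ≤ ∑ v, (F Finset.univ - F (Finset.univ.erase v)) :=
    Finset.sum_nonneg fun v _ => sub_nonneg.2 <| h.increasing <| by
      exact_mod_cast Finset.erase_subset v Finset.univ
  have hdeg (u : V) : ∑ v, (if G.Adj u v then (1 : ℝ) else 0) ≤ F {u} := by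
    have hc : cut G {u} = ∑ v, (if G.Adj u v then (1 : ℝ) else 0) := by
      rw [cut_eq_sum, Finset.sum_eq_single u]
      · refine Finset.sum_congr rfl fun v _ => ?_
        have : G.Adj u v → v ≠ u := fun h => h.ne'
        simp only [Set.mem_singleton_iff]
        grind
      · intro b _ hb
        simp [hb]
      · simp
    have h2 := h.decreasing (Set.empty_subset {u})
    rw [h.empty_right] at h2
    have h3 := h.eq_add {u}
    simp only [F, Finset.coe_singleton]
    linarith
  have hsum := Finset.sum_le_sum fun u (_ : u ∈ Finset.univ) => hdeg u
  have hu : F Finset.univ = φ₁ Set.univ := by simp [F]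
  linarith

/-! ### The Vandermonde graph -/

/-- The Vandermonde graph over a field: `(x, a)` and `(y, b)` are adjacent if `x ≠ y` and
`a - b = x * y * (x - y)`. -/
def vandermondeGraph (F : Type*) [Field F] : SimpleGraph (F × F) where
  Adj u v := u.1 ≠ v.1 ∧ u.2 - v.2 = u.1 * v.1 * (u.1 - v.1)
  symm := ⟨fun u v h => ⟨h.1.symm, by linear_combination -h.2⟩⟩
  loopless := ⟨fun _ h => h.1 rfl⟩

/-- Around a triangle the differences of second coordinates sum to zero, whereas the prescribed
values sum, up to sign, to a Vandermonde determinant of distinct elements. -/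
theorem vandermondeGraph_triangleFree {F : Type*} [Field F] (u v w : F × F)
    (huv : (vandermondeGraph F).Adj u v) (huw : (vandermondeGraph F).Adj u w) :
    ¬ (vandermondeGraph F).Adj v w := by
  intro hvw
  have h : (u.1 - v.1) * (v.1 - w.1) * (u.1 - w.1) = 0 := by
    linear_combination huw.2 - huv.2 - hvw.2
  simp only [mul_eq_zero, sub_eq_zero] at h
  rcases h with (h | h) | h
  exacts [huv.1 h, hvw.1 h, huw.1 h]

/-! ### Discrepancy and maximum cut -/

section Discrepancy

variable {F : Type*} [Field F] [Fintype F]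

/-- Shifts of a mean-zero function along a quadratic polynomial are orthogonal. -/
theorem sum_sq_sum_quadratic_shift (h2 : (2 : F) ≠ 0) (t : F → ℝ) (ht : ∑ a, t a = 0)
    (α β : F) (hα : α ≠ 0) :
    ∑ b, (∑ y, t (b + α * (y * (β - y)))) ^ 2 = Fintype.card F * ∑ a, t a ^ 2 := by
  classical
  have expand (b : F) : (∑ y, t (b + α * (y * (β - y)))) ^ 2
      = ∑ k, ∑ y, t (b + α * (y * (β - y))) * t (b + α * ((y + k) * (β - (y + k)))) := by
    rw [sq, Finset.sum_mul_sum, Finset.sum_comm (γ := F) (s := Finset.univ) (t := Finset.univ)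
      (f := fun k y => t (b + α * (y * (β - y))) * t (b + α * ((y + k) * (β - (y + k)))))]
    refine Finset.sum_congr rfl fun y _ => ?_
    exact (Equiv.sum_comp (Equiv.addLeft y)
      fun z => t (b + α * (y * (β - y))) * t (b + α * (z * (β - z)))).symm
  have shift (k y : F) :
      ∑ b, t (b + α * (y * (β - y))) * t (b + α * ((y + k) * (β - (y + k))))
        = ∑ b, t b * t (b + α * k * (β - k - 2 * y)) := by
    rw [← Equiv.sum_comp (Equiv.addRight (α * (y * (β - y))))
      fun b => t b * t (b + α * k * (β - k - 2 * y))]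
    refine Finset.sum_congr rfl fun b _ => ?_
    simp only [Equiv.coe_addRight]
    congr 2
    ring
  simp only [expand]
  -- Here `k` is the difference of the two summation points. For `k ≠ 0` the relative shift is
  -- affine in `y` with slope `-2αk ≠ 0`, so it sweeps the whole field and the mean-zero condition
  -- kills the term.
  rw [Finset.sum_comm, Finset.sum_eq_single 0]
  · rw [Finset.sum_comm]
    simp only [shift]
    simp [sq]
  · intro k _ hk
    rw [Finset.sum_comm]
    simp only [shift]
    rw [Finset.sum_comm]
    refine Finset.sum_eq_zero fun b _ => ?_
    rw [← Finset.mul_sum]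
    have hc : -(α * k * 2) ≠ 0 := neg_ne_zero.2 (mul_ne_zero (mul_ne_zero hα hk) h2)
    have : ∑ y, t (b + α * k * (β - k - 2 * y)) = ∑ a, t a := by
      rw [← Equiv.sum_comp ((Equiv.mulLeft₀ _ hc).trans
        (Equiv.addRight (b + α * k * (β - k)))) t]
      refine Finset.sum_congr rfl fun y _ => ?_
      congr 1
      change _ = -(α * k * 2) * y + (b + α * k * (β - k))
      ring
    rw [this, ht, mul_zero]
  · simp

/-- The bilinear form of the Vandermonde graph, with loops added, is small on functions with mean
zero on each fibre. -/
theorem sq_sum_le_of_fiber_sum_eq_zero (h2 : (2 : F) ≠ 0) (t : F → F → ℝ)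
    (h0 : ∀ x, ∑ a, t x a = 0) {r : ℝ} (hr : 0 ≤ r) (hcard : r ^ 2 = Fintype.card F) (hr1 : 1 ≤ r)
    (ht : ∀ x, ∑ a, t x a ^ 2 ≤ r ^ 2) :
    (∑ x, ∑ y, ∑ b, t x (b + x * y * (x - y)) * t y b) ^ 2 ≤ 2 * r ^ 11 := by
  classical
  -- These are the entries of the Gram matrix that arises on squaring after Cauchy–Schwarz. The
  -- relative shift of the fibres `x` and `z` is the quadratic `(z - x) * y * (z + x - y)`, which is
  -- nonconstant exactly off the diagonal.
  let U (x z : F) : ℝ := ∑ y, ∑ b, t x (b + x * y * (x - y)) * t z (b + z * y * (z - y))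
  have hU (x z : F) :
      U x z = ∑ b, t x b * ∑ y, t z (b + (z - x) * (y * ((z + x) - y))) := by
    simp only [U, Finset.mul_sum]
    rw [Finset.sum_comm (γ := F) (s := Finset.univ) (t := Finset.univ)
      (f := fun b y => t x b * t z (b + (z - x) * (y * ((z + x) - y))))]
    refine Finset.sum_congr rfl fun y _ => ?_
    rw [← Equiv.sum_comp (Equiv.addRight (x * y * (x - y)))
      fun b => t x b * t z (b + (z - x) * (y * ((z + x) - y)))]
    refine Finset.sum_congr rfl fun b _ => ?_
    simp only [Equiv.coe_addRight]
    congr 2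
    ring
  have hUdiag (x : F) : U x x ≤ r ^ 4 := by
    rw [hU]
    simp only [sub_self, zero_mul, add_zero, Finset.sum_const, Finset.card_univ, nsmul_eq_mul,
      ← hcard]
    have : ∑ b, t x b * (r ^ 2 * t x b) = r ^ 2 * ∑ b, t x b ^ 2 := by
      rw [Finset.mul_sum]
      exact Finset.sum_congr rfl fun b _ => by ring
    rw [this]
    nlinarith [ht x, sq_nonneg r]
  have hUoff (x z : F) (hxz : x ≠ z) : U x z ≤ r ^ 3 := by
    refine (abs_le.1 (abs_le_of_sq_le_sq ?_ (by positivity))).2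
    rw [hU]
    refine (Finset.sum_mul_sq_le_sq_mul_sq _ _ _).trans ?_
    rw [sum_sq_sum_quadratic_shift h2 (t z) (h0 z) _ _ (sub_ne_zero.2 hxz.symm), ← hcard]
    calc _ ≤ r ^ 2 * (r ^ 2 * r ^ 2) := by
          gcongr
          · exact ht x
          · exact ht z
      _ = (r ^ 3) ^ 2 := by ring
  have hW : ∑ y, ∑ b, (∑ x, t x (b + x * y * (x - y))) ^ 2 ≤ 2 * r ^ 7 := by
    have e : ∑ y, ∑ b, (∑ x, t x (b + x * y * (x - y))) ^ 2 = ∑ x, ∑ z, U x z := by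
      simp only [U, sq, Finset.sum_mul_sum]
      calc _ = ∑ y, ∑ x, ∑ b, ∑ z, t x (b + x * y * (x - y)) * t z (b + z * y * (z - y)) :=
            Finset.sum_congr rfl fun y _ => Finset.sum_comm
        _ = ∑ x, ∑ y, ∑ b, ∑ z, t x (b + x * y * (x - y)) * t z (b + z * y * (z - y)) :=
            Finset.sum_comm
        _ = ∑ x, ∑ y, ∑ z, ∑ b, t x (b + x * y * (x - y)) * t z (b + z * y * (z - y)) :=
            Finset.sum_congr rfl fun x _ => Finset.sum_congr rfl fun y _ => Finset.sum_comm
        _ = _ := Finset.sum_congr rfl fun x _ => Finset.sum_comm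
    -- There are `r ^ 4` entries of size at most `r ^ 3`, and `r ^ 2` diagonal ones of size at most
    -- `r ^ 4`: in total `r ^ 7 + r ^ 6`.
    have hb (x z : F) : U x z ≤ r ^ 3 + if x = z then r ^ 4 else 0 := by
      split_ifs with h
      · subst h
        linarith [hUdiag x, pow_nonneg hr 3]
      · linarith [hUoff x z h]
    rw [e]
    refine (Finset.sum_le_sum fun x _ => Finset.sum_le_sum fun z _ => hb x z).trans ?_
    simp only [Finset.sum_add_distrib, Finset.sum_const, Finset.card_univ, nsmul_eq_mul,
      Finset.sum_ite_eq, Finset.mem_univ, if_true, ← hcard]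
    have : r ^ 6 ≤ r ^ 7 := pow_le_pow_right₀ hr1 (by norm_num)
    nlinarith
  have hT : ∑ y, ∑ b, t y b ^ 2 ≤ r ^ 4 := by
    refine (Finset.sum_le_sum fun y _ => ht y).trans ?_
    simp only [Finset.sum_const, Finset.card_univ, nsmul_eq_mul, ← hcard]
    exact le_of_eq (by ring)
  have hR : ∑ x, ∑ y, ∑ b, t x (b + x * y * (x - y)) * t y b
      = ∑ q : F × F, (∑ x, t x (q.2 + x * q.1 * (x - q.1))) * t q.1 q.2 := by
    rw [Fintype.sum_prod_type, Finset.sum_comm]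
    refine Finset.sum_congr rfl fun y _ => ?_
    rw [Finset.sum_comm]
    exact Finset.sum_congr rfl fun b _ => (Finset.sum_mul ..).symm
  rw [hR]
  refine (Finset.sum_mul_sq_le_sq_mul_sq _ _ _).trans ?_
  rw [Fintype.sum_prod_type, Fintype.sum_prod_type]
  calc _ ≤ 2 * r ^ 7 * r ^ 4 := by
        gcongr
    _ = 2 * r ^ 11 := by ring

/-- Splitting `s` into fibre means and a mean-zero part kills the cross terms. The means contribute
a nonnegative multiple of a square, so only the mean-zero part can be negative. -/
theorem neg_le_sum_vandermonde (h2 : (2 : F) ≠ 0) (s : F → F → ℝ) (hs : ∀ x a, s x a ^ 2 = 1)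
    {q : ℝ} (hq : 1 ≤ q) (hcard : q ^ 4 = Fintype.card F) :
    -(2 * q ^ 11) ≤ ∑ x, ∑ y, ∑ b, s x (b + x * y * (x - y)) * s y b := by
  have hq0 : (q ^ 4) ≠ 0 := by positivity
  let m (x : F) : ℝ := (∑ a, s x a) / q ^ 4
  let t (x a : F) : ℝ := s x a - m x
  have hm (x : F) : ∑ a, s x a = q ^ 4 * m x := by simp only [m]; field_simp
  have h0 (x : F) : ∑ a, t x a = 0 := by
    simp only [t, Finset.sum_sub_distrib, hm, Finset.sum_const, Finset.card_univ, nsmul_eq_mul,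
      ← hcard, sub_self]
  have ht (x : F) : ∑ a, t x a ^ 2 ≤ (q ^ 2) ^ 2 := by
    have e : ∑ a, t x a ^ 2 = ∑ a, s x a ^ 2 - 2 * m x * ∑ a, s x a + q ^ 4 * m x ^ 2 := by
      rw [Finset.mul_sum, ← Finset.sum_sub_distrib, hcard, ← nsmul_eq_mul, ← Finset.card_univ,
        ← Finset.sum_const, ← Finset.sum_add_distrib]
      exact Finset.sum_congr rfl fun a _ => by simp only [t]; ring
    simp only [hs, Finset.sum_const, Finset.card_univ, nsmul_eq_mul, ← hcard, hm] at e
    rw [e]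
    nlinarith [mul_nonneg (by positivity : 0 ≤ q ^ 4) (sq_nonneg (m x))]
  have hR := sq_sum_le_of_fiber_sum_eq_zero h2 t h0 (r := q ^ 2) (by positivity)
    (by rw [← hcard]; ring) (one_le_pow₀ hq) ht
  have hR' : -(2 * q ^ 11) ≤ ∑ x, ∑ y, ∑ b, t x (b + x * y * (x - y)) * t y b := by
    refine (abs_le.1 (abs_le_of_sq_le_sq ?_ (by positivity))).1
    refine hR.trans ?_
    have : 0 ≤ q ^ 22 := by positivity
    nlinarith
  have split (x y : F) : ∑ b, s x (b + x * y * (x - y)) * s y b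
      = q ^ 4 * (m x * m y) + ∑ b, t x (b + x * y * (x - y)) * t y b := by
    have hx : ∑ b, t x (b + x * y * (x - y)) = 0 :=
      (Equiv.sum_comp (Equiv.addRight (x * y * (x - y))) (t x)).trans (h0 x)
    have e : ∑ b, s x (b + x * y * (x - y)) * s y b
        = ∑ b, t x (b + x * y * (x - y)) * t y b + (∑ b, t x (b + x * y * (x - y))) * m y
          + m x * ∑ b, t y b + q ^ 4 * (m x * m y) := by
      rw [hcard, ← nsmul_eq_mul, ← Finset.card_univ, ← Finset.sum_const, Finset.sum_mul,
        Finset.mul_sum, ← Finset.sum_add_distrib, ← Finset.sum_add_distrib,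
        ← Finset.sum_add_distrib]
      exact Finset.sum_congr rfl fun b _ => by simp only [t]; ring
    rw [e, hx, h0]
    ring
  simp only [split, Finset.sum_add_distrib]
  have hmm : 0 ≤ ∑ x, ∑ y, q ^ 4 * (m x * m y) := by
    have : ∑ x, ∑ y, q ^ 4 * (m x * m y) = q ^ 4 * (∑ x, m x) ^ 2 := by
      rw [sq, Finset.sum_mul_sum, Finset.mul_sum]
      exact Finset.sum_congr rfl fun x _ => (Finset.mul_sum ..).symm
    rw [this]
    positivity
  linarith

-- For `x ≠ y`, each `(y, b)` has exactly one neighbour in the fibre over `x`. At `x = y` the same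
-- formula yields a loop, which the last sum removes.
open Classical in
theorem sum_adj_vandermondeGraph (g : F → F → F → F → ℝ) :
    ∑ u : F × F, ∑ v : F × F, (if (vandermondeGraph F).Adj u v then g u.1 u.2 v.1 v.2 else 0)
      = ∑ x, ∑ y, ∑ b, g x (b + x * y * (x - y)) y b - ∑ x, ∑ b, g x b x b := by
  have inner (x y b : F) :
      ∑ a, (if (vandermondeGraph F).Adj (x, a) (y, b) then g x a y b else 0)
        = g x (b + x * y * (x - y)) y b - if x = y then g x b x b else 0 := by
    by_cases hxy : x = y
    · subst hxy
      simp [vandermondeGraph]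
    · simp [vandermondeGraph, hxy, sub_eq_iff_eq_add']
  calc _ = ∑ x, ∑ y, ∑ b, ∑ a,
        (if (vandermondeGraph F).Adj (x, a) (y, b) then g x a y b else 0) := by
        simp only [Fintype.sum_prod_type]
        refine Finset.sum_congr rfl fun x _ => ?_
        rw [Finset.sum_comm]
        exact Finset.sum_congr rfl fun y _ => Finset.sum_comm
    _ = _ := by
        simp only [inner, Finset.sum_sub_distrib]
        congr 1
        refine Finset.sum_congr rfl fun x _ => ?_
        rw [Finset.sum_comm]
        simp

open Classical in
theorem sum_degree_vandermondeGraph {q : ℝ} (hcard : q ^ 4 = Fintype.card F) :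
    ∑ u, ∑ v, (if (vandermondeGraph F).Adj u v then (1 : ℝ) else 0) = q ^ 12 - q ^ 8 := by
  rw [sum_adj_vandermondeGraph fun _ _ _ _ => 1]
  simp only [Finset.sum_const, Finset.card_univ, nsmul_eq_mul, ← hcard]
  ring

theorem cut_vandermondeGraph_le (h2 : (2 : F) ≠ 0) {q : ℝ} (hq : 1 ≤ q)
    (hcard : q ^ 4 = Fintype.card F) (X : Set (F × F)) :
    cut (vandermondeGraph F) X ≤ (q ^ 12 + 2 * q ^ 11) / 4 := by
  classical
  let s (x a : F) : ℝ := if (x, a) ∈ X then 1 else -1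
  have hs (x a : F) : s x a ^ 2 = 1 := by simp only [s]; split_ifs <;> norm_num
  have hQ := sum_adj_vandermondeGraph fun x a y b => s x a * s y b
  simp only [← sq, hs, Finset.sum_const, Finset.card_univ, nsmul_eq_mul, ← hcard] at hQ
  have hN := sum_degree_vandermondeGraph hcard
  have hlow := neg_le_sum_vandermonde h2 s hs hq hcard
  have hcut := cut_eq_sum (vandermondeGraph F) X
  have hcut' : cut (vandermondeGraph F) X = ∑ u, ∑ v,
      if (vandermondeGraph F).Adj u v ∧ v ∈ X ∧ u ∉ X then (1 : ℝ) else 0 := by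
    rw [hcut, Finset.sum_comm]
    simp only [(vandermondeGraph F).adj_comm]
  -- For signs, `1 - s u * s v` is 2 on cut pairs and 0 otherwise; each cut edge occurs in both
  -- orders. The loop terms `q ^ 8` cancel between `hN` and `hQ`.
  have key : 2 * cut (vandermondeGraph F) X + 2 * cut (vandermondeGraph F) X
      = ∑ u, ∑ v, (if (vandermondeGraph F).Adj u v then (1 : ℝ) else 0)
        - ∑ u : F × F, ∑ v : F × F,
          (if (vandermondeGraph F).Adj u v then s u.1 u.2 * s v.1 v.2 else 0) := by
    nth_rewrite 1 [hcut]
    rw [hcut']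
    simp only [Finset.mul_sum, ← Finset.sum_add_distrib, ← Finset.sum_sub_distrib]
    refine Finset.sum_congr rfl fun u _ => Finset.sum_congr rfl fun v _ => ?_
    by_cases ha : (vandermondeGraph F).Adj u v
    · by_cases hu : u ∈ X <;> by_cases hv : v ∈ X <;> norm_num [ha, hu, hv, s]
    · simp [ha]
  linarith

end Discrepancy

/-! ### Optimality of the factor 2 -/

theorem exists_forall_not_isBoundedMonotonicSumDecomp_cut {c : ℝ} (hc : c < 2) :
    ∃ (V : Type) (_ : Finite V) (G : SimpleGraph V),
      ¬ ∃ φ₁ φ₂ : Set V → ℝ, SetFn.IsBoundedMonotonicSumDecomp c (cut G) φ₁ φ₂ := by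
  classical
  have hpos : 0 < 2 - c := by linarith
  -- With `p = q ^ 4`, the bounds combine to `(2 - c) * q ^ 12 ≤ 2 * q ^ 8 + 2 * c * q ^ 11 ≤ 6 * q
  -- ^ 11` for `c > 0`, so `q > 6 / (2 - c)` is a contradiction. The `+ 3` makes `p` odd.
  obtain ⟨p, hpN, hp⟩ := Nat.exists_infinite_primes (⌈(6 / (2 - c)) ^ 4⌉₊ + 3)
  have : Fact p.Prime := ⟨hp⟩
  have h2 : (2 : ZMod p) ≠ 0 := by
    intro h
    have h' : ((2 : ℕ) : ZMod p) = 0 := by exact_mod_cast h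
    have := Nat.le_of_dvd two_pos ((ZMod.natCast_eq_zero_iff 2 p).1 h')
    omega
  obtain ⟨q, hq0, hqp⟩ : ∃ q : ℝ, 0 ≤ q ∧ q ^ 4 = p :=
    ⟨√√p, by positivity, by
      rw [show √√(p : ℝ) ^ 4 = (√√(p : ℝ) ^ 2) ^ 2 by ring, Real.sq_sqrt (by positivity),
        Real.sq_sqrt (by positivity)]⟩
  have hcard : q ^ 4 = Fintype.card (ZMod p) := by rw [hqp, ZMod.card]
  have hpN' : (⌈(6 / (2 - c)) ^ 4⌉₊ : ℝ) + 3 ≤ q ^ 4 := by rw [hqp]; exact_mod_cast hpN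
  have hceil := Nat.le_ceil ((6 / (2 - c)) ^ 4)
  have hq1 : 1 ≤ q := by
    by_contra! h
    have := pow_lt_one₀ hq0 h (n := 4) (by norm_num)
    linarith [Nat.cast_nonneg (α := ℝ) ⌈(6 / (2 - c)) ^ 4⌉₊]
  have hqc : 6 < (2 - c) * q := by
    have h : 6 / (2 - c) < q := lt_of_pow_lt_pow_left₀ 4 hq0 (by linarith)
    rw [div_lt_iff₀ hpos] at h
    linarith
  refine ⟨ZMod p × ZMod p, inferInstance, vandermondeGraph (ZMod p), ?_⟩
  rintro ⟨φ₁, φ₂, h⟩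
  have hlow := sum_degree_le_of_triangleFree (vandermondeGraph (ZMod p))
    vandermondeGraph_triangleFree h.toIsMonotonicSumDecomp
  rw [sum_degree_vandermondeGraph hcard] at hlow
  have hnorm := (le_abs_self _).trans (SetFn.abs_le_norm φ₁ Set.univ)
  have hcut : SetFn.norm (cut (vandermondeGraph (ZMod p))) ≤ (q ^ 12 + 2 * q ^ 11) / 4 :=
    SetFn.norm_le _ fun X => by
      rw [abs_of_nonneg]
      · exact cut_vandermondeGraph_le h2 hq1 hcard X
      · rw [cut_eq_sum]
        positivity
  have hcut0 := (abs_nonneg _).trans (SetFn.abs_le_norm (cut (vandermondeGraph (ZMod p))) ∅)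
  have hle := h.norm_left_le
  have h811 : q ^ 8 ≤ q ^ 11 := pow_le_pow_right₀ hq1 (by norm_num)
  have h11 : 0 < q ^ 11 := by positivity
  have hmain : 6 * q ^ 11 < (2 - c) * q * q ^ 11 := mul_lt_mul_of_pos_right hqc h11
  have h12 : (2 - c) * q * q ^ 11 = 2 * q ^ 12 - c * q ^ 12 := by ring
  rcases le_or_gt c 0 with hc0 | hc0
  -- For `c ≤ 0` the upper bound on `φ₁ V` is nonpositive, so it suffices that the graph has an
  -- edge.
  · have h1 := mul_nonpos_of_nonpos_of_nonneg hc0 hcut0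
    have h4 : 0 < q ^ 12 - q ^ 8 := by
      have : 3 * q ^ 8 ≤ q ^ 4 * q ^ 8 := by
        gcongr
        linarith [Nat.cast_nonneg (α := ℝ) ⌈(6 / (2 - c)) ^ 4⌉₊]
      have h8 : 0 < q ^ 8 := by positivity
      nlinarith
    linarith
  · have h1 := mul_le_mul_of_nonneg_left hcut hc0.le
    have h5 : c * q ^ 11 ≤ 2 * q ^ 11 := by gcongr
    linarith

end GraphCut

theorem mainTheorem11 :
    (∀ (V : Type*) [Finite V] (G : SimpleGraph V) (w : Sym2 V → ℝ),
      (∀ e ∈ G.edgeSet, 0 ≤ w e) →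
        SetFn.IsBoundedMonotonicSumDecomp 2 (GraphCut.weightedCut G w)
          (GraphCut.incidentWeight G w) (fun X => -GraphCut.inducedWeight G w X)) ∧
    (∀ c : ℝ, c < 2 →
      ∃ (V : Type) (_ : Finite V) (G : SimpleGraph V),
        ¬ ∃ φ₁ φ₂ : Set V → ℝ,
          SetFn.IsBoundedMonotonicSumDecomp c (GraphCut.cut G) φ₁ φ₂) :=
  ⟨fun _ _ G w hw => GraphCut.isBoundedMonotonicSumDecomp_weightedCut G w hw,
    fun _ hc => GraphCut.exists_forall_not_isBoundedMonotonicSumDecomp_cut hc⟩
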